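/- Let $\mathcal H,\mathcal G$ be real Hilbert spaces, $A:\mathcal H\rightrightarrows\mathcal H$ and $B:\mathcal G\rightrightarrows\mathcal G$ maximally monotone operators, and $L:\mathcal H\to\mathcal G$ a continuous linear operator with adjoint $L^*$. A pair $(x,v)\in\mathcal H\times\mathcal G$ is called a primal-dual solution if $-L^*v\in Ax$ and $v\in B(Lx)$; assume that at least one primal-dual solution exists. For bounded self-adjoint operators write $U\succcurlyeq V$ if $\langle x,Ux\rangle\ge\langle x,Vx\rangle$ for all $x$; let $\mathcal S_+$ be the set of bounded self-adjoint operators $U\succcurlyeq 0$, and for $\alpha>0$ let $\mathcal P_\alpha=\{U\in\mathcal S_+: U\succcurlyeq\alpha\,\mathrm{Id}\}$ (on the respective space). Let $c>0$ and, for all $k\ge0$, let $M_1^k\in\mathcal S_+(\mathcal H)$ and $M_2^k\in\mathcal S_+(\mathcal G)$ be such that $cL^*L+M_1^k\in\mathcal P_{\alpha_k}(\mathcal H)$ for some $\alpha_k>0$. Let $(x^0,z^0,y^0)\in\mathcal H\times\mathcal G\times\mathcal G$ be arbitrary and, for all $k\ge 0$, $$x^{k+1}=\left(cL^*L+M_1^k+A\right)^{-1}\left[cL^*(z^k-c^{-1}y^k)+M_1^kx^k\right],$$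 $$z^{k+1}=\left(\mathrm{Id}+c^{-1}M_2^k+c^{-1}B\right)^{-1}\left[Lx^{k+1}+c^{-1}y^k+c^{-1}M_2^kz^k\right],$$ $$y^{k+1}=y^k+c\,(Lx^{k+1}-z^{k+1}).$$ Assume that $M_1^k\succcurlyeq M_1^{k+1}$ and $M_2^k\succcurlyeq M_2^{k+1}$ for all $k\ge0$, and that one of the following holds: (I) there is $\alpha_1>0$ such that $M_1^k\in\mathcal P_{\alpha_1}(\mathcal H)$ for all $k\ge0$; (II) there are $\alpha,\alpha_2>0$ such that $L^*L\in\mathcal P_\alpha(\mathcal H)$ and $M_2^k\in\mathcal P_{\alpha_2}(\mathcal G)$ for all $k\ge0$; (III) there is $\alpha>0$ such that $L^*L\in\mathcal P_\alpha(\mathcal H)$ and $2M_2^{k+1}\succcurlyeq M_2^k\succcurlyeq M_2^{k+1}$ for all $k\ge0$. Then there is a primal-dual solution $(x,v)$ such that $(x^k,z^k,y^k)_{k\ge0}$ converges weakly to $(x,Lx,v)$. In particular (through (III)), if $\mathcal H$ and $\mathcal G$ are finite-dimensional, $L$ is injective (that is, has full column rank), $c>0$ and $M_1^k=M_2^k=0$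 for all $k$ (the scheme that becomes the classical ADMM when $A$ and $B$ are the subdifferentials of proper convex lower semicontinuous functions), then every sequence $(x^k,z^k,y^k)_{k\ge0}$ generated as above converges to $(x,Lx,v)$ for some primal-dual solution $(x,v)$. -/

import Mathlib

open Filter Topology
open scoped InnerProduct Pointwise

namespace ADMM

section SetValued

variable {H : Type*} [NormedAddCommGroup H] [InnerProductSpace ℝ H]

/-- Monotonicity of a set-valued operator `A : H ⇉ H`. -/
def IsMonotone (A : H → Set H) : Prop :=
  ∀ x y u v : H, u ∈ A x → v ∈ A y → 0 ≤ inner ℝ (x - y) (u - v)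

/-- Maximal monotonicity: monotone, without proper monotone extension (of the graph). -/
def IsMaximallyMonotone (A : H → Set H) : Prop :=
  IsMonotone A ∧ ∀ A' : H → Set H, IsMonotone A' → (∀ x, A x ⊆ A' x) → A' = A

/-- The inverse of a set-valued operator: `x ∈ A⁻¹ u` if and only if `u ∈ A x`. -/
def inverse (A : H → Set H) : H → Set H :=
  fun u => {x | u ∈ A x}

/-- The class `P_α(H)` of bounded self-adjoint positive semidefinite operators `U` with
`α • Id ≼ U` in the Loewner order. -/
def PClass (α : ℝ) (U : H →L[ℝ] H) : Prop :=
  U.IsPositive ∧ α • ContinuousLinearMap.id ℝ H ≤ U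

end SetValued

section Pair

variable {H G : Type*} [NormedAddCommGroup H] [InnerProductSpace ℝ H] [CompleteSpace H]
  [NormedAddCommGroup G] [InnerProductSpace ℝ G] [CompleteSpace G]

/-- `(x, v)` is a primal-dual solution: `-L* v ∈ A x + C x` and `v ∈ B (L x)`. -/
def IsPrimalDualSolution (A : H → Set H) (B : G → Set G) (C : H → H) (L : H →L[ℝ] G)
    (x : H) (v : G) : Prop :=
  -((L†) v) ∈ A x + {C x} ∧ v ∈ B (L x)

/-- The sequences `x, z, y` obey the three update rules of the algorithm with penalty parameter `c`
and metrics `M₁ k`, `M₂ k`. The two inverse operators are single-valued under the standing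
assumptions of the algorithm, so membership in their values is the same as equality. -/
structure Generates (A : H → Set H) (B : G → Set G) (C : H → H) (L : H →L[ℝ] G) (c : ℝ)
    (M₁ : ℕ → H →L[ℝ] H) (M₂ : ℕ → G →L[ℝ] G) (x : ℕ → H) (z y : ℕ → G) : Prop where
  x_step : ∀ k, x (k + 1) ∈
    inverse (fun p => {c • (L†) (L p) + M₁ k p} + A p)
      (c • (L†) (z k - c⁻¹ • y k) + M₁ k (x k) - C (x k))
  z_step : ∀ k, z (k + 1) ∈
    inverse (fun p => {p + c⁻¹ • M₂ k p} + c⁻¹ • B p)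
      (L (x (k + 1)) + c⁻¹ • y k + c⁻¹ • M₂ k (z k))
  y_step : ∀ k, y (k + 1) = y k + c • (L (x (k + 1)) - z (k + 1))

end Pair

/-- Weak convergence of a sequence in a real normed space. -/
def WeaklyConverges {E : Type*} [NormedAddCommGroup E] [NormedSpace ℝ E] (u : ℕ → E) (a : E) :
    Prop :=
  Tendsto (fun k => toWeakSpace ℝ E (u k)) atTop (𝓝 (toWeakSpace ℝ E a))

end ADMM

/-! The `energy` is a squared distance to a solution, weighted by `M₁ k`, `M₂ k + c • Id` and `c⁻¹ •
Id`. Testing the monotonicity of `A` and `B` at the new iterate against a solution gives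
`energy_step`: the energy drops by at least `⟪M₁ dx, dx⟫ + ⟪M₂ dz, dz⟫ + c ‖L x(k+1) - z(k)‖²`,
where `dx`, `dz` are the increments. Decreasing metrics preserve this descent, so these three terms
tend to zero.

Each regime then yields `dz → 0` and `L x(k) - z(k) → 0`: the first two by coercivity of `M₁` or
`M₂`, the third by comparing two consecutive inclusions for `B` (`tendsto_dz_of_le_two_smul`).
Uniform coercivity of `M₁ k + L†L` bounds the iterates, weak cluster points are solutions
(`isPrimalDualSolution_of_weak_limit`), and an Opial argument with varying metrics
(`weak_limit_unique`) leaves only one cluster point. -/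

namespace ADMM

/-! ### Positive operators and decreasing metrics -/

section PositiveOperators

variable {H : Type*} [NormedAddCommGroup H] [InnerProductSpace ℝ H]

lemma inner_self_le_of_le {S T : H →L[ℝ] H} (h : S ≤ T) (s : H) :
    inner ℝ (S s) s ≤ inner ℝ (T s) s := by
  have := (ContinuousLinearMap.le_def S T).1 h |>.inner_nonneg_left s
  simpa [inner_sub_left] using this

lemma inner_sub_self_of_isPositive {T : H →L[ℝ] H} (hT : T.IsPositive) (p d : H) :
    inner ℝ (T (p - d)) (p - d)
      = inner ℝ (T p) p - 2 * inner ℝ (T d) p + inner ℝ (T d) d := by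
  have h : inner ℝ (T p) d = inner ℝ (T d) p := by
    rw [hT.inner_left_eq_inner_right, real_inner_comm]
  simp only [map_sub, inner_sub_left, inner_sub_right, h]
  ring

/-- Cauchy–Schwarz for the semi-inner product of a positive operator. -/
lemma inner_sq_le_of_isPositive {T : H →L[ℝ] H} (hT : T.IsPositive) (s u : H) :
    inner ℝ (T s) u ^ 2 ≤ inner ℝ (T s) s * inner ℝ (T u) u := by
  have h := discrim_le_zero (a := inner ℝ (T s) s) (b := -2 * inner ℝ (T s) u)
    (c := inner ℝ (T u) u) fun t => by
      have h1 := hT.inner_nonneg_left (u - t • s)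
      rw [inner_sub_self_of_isPositive hT] at h1
      simp only [map_smul, inner_smul_left, inner_smul_right, conj_trivial] at h1
      linarith
  rw [discrim] at h
  linarith

/-- Cauchy–Schwarz with `u = T s`, followed by cancelling `‖T s‖²`. Bounding by `N` instead of `T`
makes the constant uniform along a decreasing sequence, with `N = M 0`. -/
lemma norm_sq_le_of_le {T N : H →L[ℝ] H} (hT : T.IsPositive) (hTN : T ≤ N) (s : H) :
    ‖T s‖ ^ 2 ≤ ‖N‖ * inner ℝ (T s) s := by
  have h1 := inner_sq_le_of_isPositive hT s (T s)
  rw [real_inner_self_eq_norm_sq] at h1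
  have h2 : inner ℝ (T (T s)) (T s) ≤ ‖N‖ * ‖T s‖ ^ 2 :=
    calc inner ℝ (T (T s)) (T s) ≤ inner ℝ (N (T s)) (T s) := inner_self_le_of_le hTN _
      _ ≤ ‖N (T s)‖ * ‖T s‖ := real_inner_le_norm _ _
      _ ≤ (‖N‖ * ‖T s‖) * ‖T s‖ := by gcongr; exact N.le_opNorm _
      _ = _ := by ring
  have h0 := hT.inner_nonneg_left s
  have h3 : (‖T s‖ ^ 2) * ‖T s‖ ^ 2 ≤ (‖N‖ * inner ℝ (T s) s) * ‖T s‖ ^ 2 := by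
    nlinarith [mul_le_mul_of_nonneg_left h2 h0]
  rcases (sq_nonneg ‖T s‖).eq_or_lt with h | h
  · rw [← h]; positivity
  · exact le_of_mul_le_mul_right h3 h

lemma le_zero_of_antitone {M : ℕ → H →L[ℝ] H} (hM : ∀ k, M (k + 1) ≤ M k) (k : ℕ) :
    M k ≤ M 0 :=
  antitone_nat_of_succ_le hM (Nat.zero_le k)

/-- A decreasing sequence of positive operators converges strongly. -/
lemma exists_tendsto_apply_of_antitone [CompleteSpace H] {M : ℕ → H →L[ℝ] H}
    (hpos : ∀ k, (M k).IsPositive) (hM : ∀ k, M (k + 1) ≤ M k) (s : H) :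
    ∃ t, Tendsto (fun k => M k s) atTop (𝓝 t) := by
  have hanti := antitone_nat_of_succ_le hM
  have hq : CauchySeq fun k => inner ℝ (M k s) s := by
    refine (tendsto_atTop_ciInf (fun j k hjk => inner_self_le_of_le (hanti hjk) s) ?_).cauchySeq
    exact ⟨0, by rintro _ ⟨k, rfl⟩; exact (hpos k).inner_nonneg_left s⟩
  -- The quadratic forms converge as decreasing scalars; since `0 ≤ M j - M k ≤ M 0`, they control
  -- the vectors.
  have hdiff : ∀ j k, j ≤ k →
      ‖M j s - M k s‖ ^ 2 ≤ ‖M 0‖ * |inner ℝ (M j s) s - inner ℝ (M k s) s| := by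
    intro j k hjk
    have hp : (M j - M k).IsPositive := hanti hjk
    have hle : M j - M k ≤ M 0 := by
      rw [ContinuousLinearMap.le_def, sub_sub_eq_add_sub, add_sub_right_comm]
      exact ContinuousLinearMap.IsPositive.add (le_zero_of_antitone hM j) (hpos k)
    have h := norm_sq_le_of_le hp hle s
    simp only [sub_apply, inner_sub_left] at h
    exact h.trans (by gcongr; exact le_abs_self _)
  refine cauchySeq_tendsto_of_complete (Metric.cauchySeq_iff.2 fun ε hε => ?_)
  obtain ⟨n, hn⟩ := Metric.cauchySeq_iff.1 hq (ε ^ 2 / (‖M 0‖ + 1)) (by positivity)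
  have key : ∀ j ≥ n, ∀ k ≥ n, j ≤ k → dist (M j s) (M k s) < ε := by
    intro j hj k hk hjk
    have h1 := hn j hj k hk
    rw [Real.dist_eq, lt_div_iff₀ (by positivity)] at h1
    have h2 := hdiff j k hjk
    rw [dist_eq_norm]
    refine lt_of_pow_lt_pow_left₀ 2 hε.le ?_
    nlinarith [abs_nonneg (inner ℝ (M j s) s - inner ℝ (M k s) s)]
  refine ⟨n, fun j hj k hk => ?_⟩
  rcases le_total j k with h | h
  · exact key j hj k hk h
  · rw [dist_comm]; exact key k hk j hj h

/-- If `⟪M k d_k, d_k⟫ → 0` for a decreasing sequence of positive operators, then `M k d_k → 0`. -/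
lemma tendsto_apply_zero_of_inner {M : ℕ → H →L[ℝ] H}
    (hpos : ∀ k, (M k).IsPositive) (hM : ∀ k, M (k + 1) ≤ M k) {d : ℕ → H}
    (hd : Tendsto (fun k => inner ℝ (M k (d k)) (d k)) atTop (𝓝 0)) :
    Tendsto (fun k => M k (d k)) atTop (𝓝 0) := by
  have h2 : Tendsto (fun k => ‖M k (d k)‖ ^ 2) atTop (𝓝 0) := by
    refine squeeze_zero (fun k => sq_nonneg _)
      (fun k => norm_sq_le_of_le (hpos k) (le_zero_of_antitone hM k) (d k)) ?_
    simpa using hd.const_mul ‖M 0‖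
  rw [tendsto_zero_iff_norm_tendsto_zero]
  simpa using h2.sqrt

lemma PClass.mul_norm_sq_le {α : ℝ} {U : H →L[ℝ] H} (h : PClass α U) (s : H) :
    α * ‖s‖ ^ 2 ≤ inner ℝ (U s) s := by
  simpa [inner_smul_left] using inner_self_le_of_le h.2 s

lemma tendsto_zero_of_coercive {M : ℕ → H →L[ℝ] H} {α : ℝ} (hα : 0 < α)
    (hM : ∀ k, PClass α (M k)) {d : ℕ → H}
    (hd : Tendsto (fun k => inner ℝ (M k (d k)) (d k)) atTop (𝓝 0)) :
    Tendsto d atTop (𝓝 0) := by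
  have h2 : Tendsto (fun k => ‖d k‖ ^ 2) atTop (𝓝 0) := by
    refine squeeze_zero (fun k => sq_nonneg _) (fun k => ?_) (by simpa using hd.const_mul α⁻¹)
    rw [le_inv_mul_iff₀ hα]
    exact (hM k).mul_norm_sq_le (d k)
  rw [tendsto_zero_iff_norm_tendsto_zero]
  simpa using h2.sqrt

end PositiveOperators

/-! ### Maximal monotonicity -/

section SetValuedOperators

variable {H : Type*} [NormedAddCommGroup H] [InnerProductSpace ℝ H]

/-- A point monotonically related to the graph of a maximally monotone operator lies on it. -/
lemma IsMaximallyMonotone.mem {A : H → Set H} (hA : IsMaximallyMonotone A) {x w : H}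
    (h : ∀ p u, u ∈ A p → 0 ≤ inner ℝ (x - p) (w - u)) : w ∈ A x := by
  -- Adjoining the single pair `(x, w)` to the graph keeps it monotone, so maximality absorbs it.
  have hext := hA.2 (fun p => A p ∪ {u | p = x ∧ u = w}) ?_ fun p => Set.subset_union_left
  · rw [← hext]; exact Or.inr ⟨rfl, rfl⟩
  · rintro p q u v (hu | ⟨rfl, rfl⟩) (hv | ⟨rfl, rfl⟩)
    · exact hA.1 _ _ _ _ hu hv
    · rw [← neg_sub q p, ← neg_sub v u, inner_neg_neg]; exact h _ _ hu
    · exact h _ _ hv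
    · simp

end SetValuedOperators

/-! ### Weak limits -/

section WeakConvergence

variable {H : Type*} [NormedAddCommGroup H] [InnerProductSpace ℝ H]

/-- Bounded families in a Hilbert space have weak limits along ultrafilters. -/
lemma exists_weak_limit [CompleteSpace H] {ι : Type*} (U : Ultrafilter ι) {x : ι → H} {R : ℝ}
    (hR : ∀ k, ‖x k‖ ≤ R) :
    ∃ a, ∀ w, Tendsto (fun k => inner ℝ (x k) w) U (𝓝 (inner ℝ a w)) := by
  let f : ι → WeakDual ℝ H := fun k =>
    StrongDual.toWeakDual (InnerProductSpace.toDual ℝ H (x k))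
  have hf : ∀ k, f k ∈ WeakDual.toStrongDual ⁻¹' Metric.closedBall (0 : StrongDual ℝ H) R := by
    intro k
    simpa [f] using hR k
  -- Banach–Alaoglu, transported through the Riesz isometry.
  obtain ⟨φ, -, hφ⟩ := (WeakDual.isCompact_closedBall (0 : StrongDual ℝ H) R).ultrafilter_le_nhds
    (U.map f) (by
      rw [le_principal_iff, Ultrafilter.mem_coe, Ultrafilter.mem_map]
      exact univ_mem' hf)
  refine ⟨(InnerProductSpace.toDual ℝ H).symm (WeakDual.toStrongDual φ), fun w => ?_⟩
  have h := ((WeakDual.eval_continuous w).tendsto φ).comp (show Tendsto f U (𝓝 φ) from hφ)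
  simpa [f, Function.comp_def] using h

/-- The pairing of a bounded weakly null sequence with a null sequence vanishes. -/
lemma tendsto_inner_zero_of_bounded {ι : Type*} {l : Filter ι} {u w : ι → H} {R : ℝ}
    (hu : ∀ k, ‖u k‖ ≤ R) (hw : Tendsto w l (𝓝 0)) :
    Tendsto (fun k => inner ℝ (u k) (w k)) l (𝓝 0) := by
  refine squeeze_zero_norm (a := fun k => R * ‖w k‖) (fun k => ?_) ?_
  · exact (norm_inner_le_norm _ _).trans (by gcongr; exact hu k)
  · simpa using hw.norm.const_mul R

lemma exists_norm_le_of_norm_sub_sq_le {E : Type*} [NormedAddCommGroup E] {u : ℕ → E} {a : E}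
    {C : ℝ}
    (h : ∀ k, ‖u k - a‖ ^ 2 ≤ C) : ∃ R, ∀ k, ‖u k‖ ≤ R :=
  ⟨√C + ‖a‖, fun k => by
    have h1 : ‖u k - a‖ ≤ √C := Real.le_sqrt_of_sq_le (h k)
    have h2 := norm_le_norm_sub_add (u k) a
    linarith⟩

lemma tendsto_inner_of_weak_limit {ι : Type*} {l : Filter ι} {u t : ι → H} {a b : H} {R : ℝ}
    (hR : ∀ k, ‖u k‖ ≤ R) (hu : ∀ w, Tendsto (fun k => inner ℝ (u k) w) l (𝓝 (inner ℝ a w)))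
    (ht : Tendsto t l (𝓝 b)) :
    Tendsto (fun k => inner ℝ (t k) (u k)) l (𝓝 (inner ℝ b a)) := by
  have h1 := (tendsto_inner_zero_of_bounded hR (tendsto_sub_nhds_zero_iff.2 ht)).add (hu b)
  rw [zero_add, real_inner_comm] at h1
  refine h1.congr fun k => ?_
  rw [inner_sub_right, sub_add_cancel, real_inner_comm]

variable {G : Type*} [NormedAddCommGroup G] [InnerProductSpace ℝ G]

lemma injective_topDualPairing_flip {E : Type*} [NormedAddCommGroup E] [NormedSpace ℝ E] :
    Function.Injective (topDualPairing ℝ E).flip := fun _ _ hpq =>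
  (SeparatingDual.eq_iff_forall_dual_eq (R := ℝ)).2 fun f => LinearMap.congr_fun hpq f

/-- `H × G × G` carries the max norm and is not an inner product space, so Riesz is applied to the
restrictions of a functional to the three factors. -/
lemma weaklyConverges_of_inner [CompleteSpace H] [CompleteSpace G] {x : ℕ → H} {z y : ℕ → G}
    {a : H} {b v : G}
    (hx : ∀ w, Tendsto (fun k => inner ℝ (x k) w) atTop (𝓝 (inner ℝ a w)))
    (hz : ∀ w, Tendsto (fun k => inner ℝ (z k) w) atTop (𝓝 (inner ℝ b w)))
    (hy : ∀ w, Tendsto (fun k => inner ℝ (y k) w) atTop (𝓝 (inner ℝ v w))) :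
    WeaklyConverges (fun k => (x k, z k, y k)) (a, b, v) := by
  have hsum : ∀ (f : StrongDual ℝ (H × G × G)) (p : H × G × G),
      f p = inner ℝ p.1 ((InnerProductSpace.toDual ℝ H).symm
          (f ∘L ContinuousLinearMap.inl ℝ H (G × G)))
        + inner ℝ p.2.1 ((InnerProductSpace.toDual ℝ G).symm
          (f ∘L ContinuousLinearMap.inr ℝ H (G × G) ∘L ContinuousLinearMap.inl ℝ G G))
        + inner ℝ p.2.2 ((InnerProductSpace.toDual ℝ G).symm
          (f ∘L ContinuousLinearMap.inr ℝ H (G × G) ∘L ContinuousLinearMap.inr ℝ G G)) := by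
    rintro f ⟨p, q, r⟩
    simp only [real_inner_comm _ p, real_inner_comm _ q, real_inner_comm _ r,
      InnerProductSpace.toDual_symm_apply, ContinuousLinearMap.comp_apply,
      ContinuousLinearMap.inl_apply, ContinuousLinearMap.inr_apply, ← map_add]
    simp
  refine (WeakBilin.tendsto_iff_forall_eval_tendsto _ injective_topDualPairing_flip).2 fun f => ?_
  change Tendsto (fun k => f (x k, z k, y k)) atTop (𝓝 (f (a, b, v)))
  simp only [hsum]
  exact ((hx _).add (hz _)).add (hy _)

/-- The weak topology is Hausdorff, so in finite dimensions the linear identity back to the norm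
topology is continuous. -/
lemma WeaklyConverges.tendsto {E : Type*} [NormedAddCommGroup E] [NormedSpace ℝ E]
    [FiniteDimensional ℝ E] {u : ℕ → E} {a : E} (h : WeaklyConverges u a) :
    Tendsto u atTop (𝓝 a) := by
  have : FiniteDimensional ℝ (WeakSpace ℝ E) := Module.Finite.equiv (toWeakSpace ℝ E)
  have : T2Space (WeakSpace ℝ E) := by
    refine (WeakBilin.isEmbedding (B := (topDualPairing ℝ E).flip)
      injective_topDualPairing_flip).t2Space
  have hc : Continuous (toWeakSpace ℝ E).symm.toLinearMap :=
    LinearMap.continuous_of_finiteDimensional _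
  simpa [Function.comp_def] using (hc.tendsto _).comp h

end WeakConvergence

/-! ### The Lyapunov functional -/

section Energy

variable {H G : Type*} [NormedAddCommGroup H] [InnerProductSpace ℝ H]
  [NormedAddCommGroup G] [InnerProductSpace ℝ G]

/-- The Lyapunov functional of the algorithm, evaluated at the deviations from a solution. -/
noncomputable def energy (c : ℝ) (M₁ : H →L[ℝ] H) (M₂ : G →L[ℝ] G) (p : H) (q w : G) : ℝ :=
  inner ℝ (M₁ p) p + inner ℝ (M₂ q) q + c * ‖q‖ ^ 2 + c⁻¹ * ‖w‖ ^ 2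

lemma energy_anti {c : ℝ} {M₁ N₁ : H →L[ℝ] H} {M₂ N₂ : G →L[ℝ] G} (h₁ : N₁ ≤ M₁) (h₂ : N₂ ≤ M₂)
    (p : H) (q w : G) : energy c N₁ N₂ p q w ≤ energy c M₁ M₂ p q w := by
  have := inner_self_le_of_le h₁ p
  have := inner_self_le_of_le h₂ q
  unfold energy
  linarith

end Energy

/-! ### Energy descent along the iteration -/

section Iteration

variable {H G : Type*} [NormedAddCommGroup H] [InnerProductSpace ℝ H] [CompleteSpace H]
  [NormedAddCommGroup G] [InnerProductSpace ℝ G] [CompleteSpace G]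

lemma isPrimalDualSolution_zero_iff {A : H → Set H} {B : G → Set G} {L : H →L[ℝ] G} {x : H}
    {v : G} : IsPrimalDualSolution A B 0 L x v ↔ -((L†) v) ∈ A x ∧ v ∈ B (L x) := by
  simp [IsPrimalDualSolution]

/-- The hypotheses common to all three parameter regimes of the algorithm. -/
structure IsRun (A : H → Set H) (B : G → Set G) (L : H →L[ℝ] G) (c : ℝ)
    (M₁ : ℕ → H →L[ℝ] H) (M₂ : ℕ → G →L[ℝ] G) (x : ℕ → H) (z y : ℕ → G) : Prop where
  maxA : IsMaximallyMonotone A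
  maxB : IsMaximallyMonotone B
  c_pos : 0 < c
  pos₁ : ∀ k, (M₁ k).IsPositive
  pos₂ : ∀ k, (M₂ k).IsPositive
  anti₁ : ∀ k, M₁ (k + 1) ≤ M₁ k
  anti₂ : ∀ k, M₂ (k + 1) ≤ M₂ k
  gen : Generates A B 0 L c M₁ M₂ x z y

/-- The decrease of the energy in one step, with `p, q, w` the new deviations from a solution,
`d, e` the increments of the first two variables, and `r` the new primal residual. -/
lemma energy_step {L : H →L[ℝ] G} {c : ℝ} (hc : 0 < c) {M₁ : H →L[ℝ] H} {M₂ : G →L[ℝ] G}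
    (h₁ : M₁.IsPositive) (h₂ : M₂.IsPositive) {p d : H} {q e w r : G} (hr : r = L p - q)
    (hA : 0 ≤ inner ℝ p (-((L†) (w + c • e)) - M₁ d))
    (hB : 0 ≤ inner ℝ q (w - M₂ e)) :
    energy c M₁ M₂ p q w + (inner ℝ (M₁ d) d + inner ℝ (M₂ e) e + c * ‖r + e‖ ^ 2)
      ≤ energy c M₁ M₂ (p - d) (q - e) (w - c • r) := by
  have hLp : L p = q + r := by rw [hr]; abel
  have hA' : 0 ≤ -inner ℝ q w - inner ℝ r w - c * inner ℝ q e - c * inner ℝ r e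
      - inner ℝ (M₁ d) p := by
    rw [inner_sub_right, inner_neg_right, ContinuousLinearMap.adjoint_inner_right, hLp,
      real_inner_comm (M₁ d) p] at hA
    simp only [inner_add_left, inner_add_right, inner_smul_right] at hA
    linarith
  rw [inner_sub_right, real_inner_comm (M₂ e) q] at hB
  have e1 : ‖q - e‖ ^ 2 = ‖q‖ ^ 2 - 2 * inner ℝ q e + ‖e‖ ^ 2 := norm_sub_sq_real q e
  have e2 : ‖r + e‖ ^ 2 = ‖r‖ ^ 2 + 2 * inner ℝ r e + ‖e‖ ^ 2 := norm_add_sq_real r e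
  have e3 : c⁻¹ * ‖w - c • r‖ ^ 2 = c⁻¹ * ‖w‖ ^ 2 - 2 * inner ℝ r w + c * ‖r‖ ^ 2 := by
    rw [norm_sub_sq_real, norm_smul, inner_smul_right, real_inner_comm, Real.norm_eq_abs, mul_pow,
      sq_abs]
    field_simp
  -- After polarization, the claim is twice the sum of `hA'` and `hB`.
  unfold energy
  rw [inner_sub_self_of_isPositive h₁, inner_sub_self_of_isPositive h₂, e1, e2, e3]
  linarith

namespace IsRun

variable {A : H → Set H} {B : G → Set G} {L : H →L[ℝ] G} {c : ℝ}
  {M₁ : ℕ → H →L[ℝ] H} {M₂ : ℕ → G →L[ℝ] G} {x : ℕ → H} {z y : ℕ → G}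

/-- Optimality condition of the `x`-step, with `y k` eliminated through the `y`-step. The extra `c •
(z (k + 1) - z k)` appears because the `x`-step uses the old `z`. -/
lemma mem_A (h : IsRun A B L c M₁ M₂ x z y) (k : ℕ) :
    -((L†) (y (k + 1) + c • (z (k + 1) - z k))) - M₁ k (x (k + 1) - x k) ∈ A (x (k + 1)) := by
  have hc := h.c_pos.ne'
  obtain ⟨u, hu, a, ha, hua⟩ := h.gen.x_step k
  rw [Set.mem_singleton_iff] at hu
  convert ha using 1
  rw [← sub_eq_iff_eq_add'.2 hua.symm, hu, h.gen.y_step k]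
  simp only [Pi.zero_apply, sub_zero, map_sub, map_add, map_smul, smul_sub, smul_inv_smul₀ hc]
  abel

lemma mem_B (h : IsRun A B L c M₁ M₂ x z y) (k : ℕ) :
    y (k + 1) - M₂ k (z (k + 1) - z k) ∈ B (z (k + 1)) := by
  have hc := h.c_pos.ne'
  obtain ⟨u, hu, a, ⟨b, hb, rfl⟩, hua⟩ := h.gen.z_step k
  rw [Set.mem_singleton_iff] at hu
  convert hb using 1
  have h1 : b = c • (L (x (k + 1)) + c⁻¹ • y k + c⁻¹ • M₂ k (z k) - u) := by
    rw [← hua]; simp [smul_inv_smul₀ hc]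
  rw [h1, hu, h.gen.y_step k]
  simp only [map_sub, smul_sub, smul_add, smul_inv_smul₀ hc]
  abel

/-- The energy of the iterates relative to a solution decreases. -/
lemma energy_succ_le (h : IsRun A B L c M₁ M₂ x z y) {xs : H} {v : G}
    (hs : IsPrimalDualSolution A B 0 L xs v) (k : ℕ) :
    energy c (M₁ (k + 1)) (M₂ (k + 1)) (x (k + 1) - xs) (z (k + 1) - L xs) (y (k + 1) - v)
        + (inner ℝ (M₁ k (x (k + 1) - x k)) (x (k + 1) - x k)
          + inner ℝ (M₂ k (z (k + 1) - z k)) (z (k + 1) - z k)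
          + c * ‖L (x (k + 1)) - z k‖ ^ 2)
      ≤ energy c (M₁ k) (M₂ k) (x k - xs) (z k - L xs) (y k - v) := by
  rw [isPrimalDualSolution_zero_iff] at hs
  have hA := h.maxA.1 _ _ _ _ (h.mem_A k) hs.1
  have hB := h.maxB.1 _ _ _ _ (h.mem_B k) hs.2
  have := energy_step (L := L) h.c_pos (h.pos₁ k) (h.pos₂ k) (p := x (k + 1) - xs)
    (d := x (k + 1) - x k) (q := z (k + 1) - L xs) (e := z (k + 1) - z k) (w := y (k + 1) - v)
    (r := L (x (k + 1)) - z (k + 1)) (by rw [map_sub]; abel)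
    (by convert hA using 2; simp only [map_sub, map_add, map_smul]; abel)
    (by convert hB using 2; abel)
  -- `energy_step` keeps the metrics of step `k`; monotonicity of the metrics passes to those of
  -- step `k + 1`.
  have hm := energy_anti (c := c) (h.anti₁ k) (h.anti₂ k) (x (k + 1) - xs) (z (k + 1) - L xs)
    (y (k + 1) - v)
  have e1 : y (k + 1) - v - c • (L (x (k + 1)) - z (k + 1)) = y k - v := by
    rw [h.gen.y_step k]; abel
  simp only [sub_sub_sub_cancel_left, sub_add_sub_cancel, e1] at this
  linarith

lemma energy_nonneg (h : IsRun A B L c M₁ M₂ x z y) (k : ℕ) (p : H) (q w : G) :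
    0 ≤ energy c (M₁ k) (M₂ k) p q w := by
  have := (h.pos₁ k).inner_nonneg_left p
  have := (h.pos₂ k).inner_nonneg_left q
  have := h.c_pos
  unfold energy
  positivity

lemma dissipation_nonneg (h : IsRun A B L c M₁ M₂ x z y) (k : ℕ) (d : H) (e f : G) :
    0 ≤ inner ℝ (M₁ k d) d + inner ℝ (M₂ k e) e + c * ‖f‖ ^ 2 := by
  have := (h.pos₁ k).inner_nonneg_left d
  have := (h.pos₂ k).inner_nonneg_left e
  have := h.c_pos
  positivity

lemma energy_antitone (h : IsRun A B L c M₁ M₂ x z y) {xs : H} {v : G}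
    (hs : IsPrimalDualSolution A B 0 L xs v) :
    Antitone fun k => energy c (M₁ k) (M₂ k) (x k - xs) (z k - L xs) (y k - v) :=
  antitone_nat_of_succ_le fun k => by
    have := h.energy_succ_le hs k
    have := h.dissipation_nonneg k (x (k + 1) - x k) (z (k + 1) - z k) (L (x (k + 1)) - z k)
    linarith

lemma exists_tendsto_energy (h : IsRun A B L c M₁ M₂ x z y) {xs : H} {v : G}
    (hs : IsPrimalDualSolution A B 0 L xs v) :
    ∃ e, Tendsto (fun k => energy c (M₁ k) (M₂ k) (x k - xs) (z k - L xs) (y k - v)) atTop (𝓝 e) :=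
  ⟨_, tendsto_atTop_ciInf (h.energy_antitone hs)
    ⟨0, by rintro _ ⟨k, rfl⟩; exact h.energy_nonneg k _ _ _⟩⟩

/-- The dissipated amount is at most the difference of consecutive terms of a convergent sequence.
-/
lemma tendsto_dissipation (h : IsRun A B L c M₁ M₂ x z y)
    (hsol : ∃ (xs : H) (v : G), IsPrimalDualSolution A B 0 L xs v) :
    Tendsto (fun k => inner ℝ (M₁ k (x (k + 1) - x k)) (x (k + 1) - x k)
          + inner ℝ (M₂ k (z (k + 1) - z k)) (z (k + 1) - z k)
          + c * ‖L (x (k + 1)) - z k‖ ^ 2) atTop (𝓝 0) := by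
  obtain ⟨xs, v, hs⟩ := hsol
  obtain ⟨e, he⟩ := h.exists_tendsto_energy hs
  have hd := he.sub (he.comp (tendsto_add_atTop_nat 1))
  rw [sub_self] at hd
  refine squeeze_zero (fun k => h.dissipation_nonneg k _ _ _) (fun k => ?_) hd
  have := h.energy_succ_le hs k
  simp only [Function.comp_apply]
  linarith

lemma tendsto_inner_dx (h : IsRun A B L c M₁ M₂ x z y)
    (hsol : ∃ (xs : H) (v : G), IsPrimalDualSolution A B 0 L xs v) :
    Tendsto (fun k => inner ℝ (M₁ k (x (k + 1) - x k)) (x (k + 1) - x k)) atTop (𝓝 0) :=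
  squeeze_zero (fun k => (h.pos₁ k).inner_nonneg_left _) (fun k => by
    have := (h.pos₂ k).inner_nonneg_left (z (k + 1) - z k)
    have := h.c_pos
    have : 0 ≤ c * ‖L (x (k + 1)) - z k‖ ^ 2 := by positivity
    linarith) (h.tendsto_dissipation hsol)

lemma tendsto_inner_dz (h : IsRun A B L c M₁ M₂ x z y)
    (hsol : ∃ (xs : H) (v : G), IsPrimalDualSolution A B 0 L xs v) :
    Tendsto (fun k => inner ℝ (M₂ k (z (k + 1) - z k)) (z (k + 1) - z k)) atTop (𝓝 0) :=
  squeeze_zero (fun k => (h.pos₂ k).inner_nonneg_left _) (fun k => by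
    have := (h.pos₁ k).inner_nonneg_left (x (k + 1) - x k)
    have := h.c_pos
    have : 0 ≤ c * ‖L (x (k + 1)) - z k‖ ^ 2 := by positivity
    linarith) (h.tendsto_dissipation hsol)

lemma tendsto_norm_sq_shifted_residual (h : IsRun A B L c M₁ M₂ x z y)
    (hsol : ∃ (xs : H) (v : G), IsPrimalDualSolution A B 0 L xs v) :
    Tendsto (fun k => ‖L (x (k + 1)) - z k‖ ^ 2) atTop (𝓝 0) := by
  have hc := h.c_pos
  have := (h.tendsto_dissipation hsol).const_mul c⁻¹
  rw [mul_zero] at this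
  refine squeeze_zero (fun k => sq_nonneg _) (fun k => ?_) this
  have := (h.pos₁ k).inner_nonneg_left (x (k + 1) - x k)
  have := (h.pos₂ k).inner_nonneg_left (z (k + 1) - z k)
  rw [le_inv_mul_iff₀ hc]
  linarith

lemma tendsto_shifted_residual (h : IsRun A B L c M₁ M₂ x z y)
    (hsol : ∃ (xs : H) (v : G), IsPrimalDualSolution A B 0 L xs v) :
    Tendsto (fun k => L (x (k + 1)) - z k) atTop (𝓝 0) := by
  rw [tendsto_zero_iff_norm_tendsto_zero]
  simpa using (h.tendsto_norm_sq_shifted_residual hsol).sqrt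

end IsRun

end Iteration

/-! ### Cluster points, uniqueness, and the three regimes -/

section Convergence

variable {H G : Type*} [NormedAddCommGroup H] [InnerProductSpace ℝ H] [CompleteSpace H]
  [NormedAddCommGroup G] [InnerProductSpace ℝ G] [CompleteSpace G]

/-- Demiclosedness of the primal-dual inclusion: weak limits of asymptotic solutions are
solutions. -/
lemma isPrimalDualSolution_of_weak_limit {A : H → Set H} {B : G → Set G} {L : H →L[ℝ] G}
    (hA : IsMaximallyMonotone A) (hB : IsMaximallyMonotone B) {ι : Type*} {l : Filter ι} [l.NeBot]
    {x a : ι → H} {z b y : ι → G} {R : ℝ} (hxR : ∀ k, ‖x k‖ ≤ R) (hzR : ∀ k, ‖z k‖ ≤ R)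
    (hyR : ∀ k, ‖y k‖ ≤ R) (ha : ∀ k, a k ∈ A (x k)) (hb : ∀ k, b k ∈ B (z k))
    (ha0 : Tendsto (fun k => a k + (L†) (y k)) l (𝓝 0))
    (hb0 : Tendsto (fun k => b k - y k) l (𝓝 0))
    (hr : Tendsto (fun k => L (x k) - z k) l (𝓝 0)) {xs : H} {v : G}
    (hx : ∀ w, Tendsto (fun k => inner ℝ (x k) w) l (𝓝 (inner ℝ xs w)))
    (hz : ∀ w, Tendsto (fun k => inner ℝ (z k) w) l (𝓝 (inner ℝ (L xs) w)))
    (hy : ∀ w, Tendsto (fun k => inner ℝ (y k) w) l (𝓝 (inner ℝ v w))) :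
    IsPrimalDualSolution A B 0 L xs v := by
  have key : ∀ p u q w, u ∈ A p → w ∈ B q →
      0 ≤ inner ℝ (xs - p) (-((L†) v) - u) + inner ℝ (L xs - q) (v - w) := by
    intro p u q w hu hw
    have e1 : Tendsto (fun k => inner ℝ (x k - p) (a k + (L†) (y k))) l (𝓝 0) :=
      tendsto_inner_zero_of_bounded (R := R + ‖p‖)
        (fun k => (norm_sub_le _ _).trans (by gcongr; exact hxR k)) ha0
    have e2 : Tendsto (fun k => inner ℝ (z k - q) (b k - y k)) l (𝓝 0) :=
      tendsto_inner_zero_of_bounded (R := R + ‖q‖)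
        (fun k => (norm_sub_le _ _).trans (by gcongr; exact hzR k)) hb0
    have e3 := tendsto_inner_zero_of_bounded hyR hr
    have hlim := ((((e1.add e2).sub e3).add (hy (L p - q))).sub
      ((hx u).sub_const (inner ℝ p u))).sub ((hz w).sub_const (inner ℝ q w))
    refine le_trans (ge_of_tendsto' hlim fun k => ?_) (le_of_eq ?_)
    · have h1 := hA.1 _ _ _ _ (ha k) hu
      have h2 := hB.1 _ _ _ _ (hb k) hw
      simp only [inner_sub_left, inner_sub_right, inner_add_right,
        ContinuousLinearMap.adjoint_inner_right, map_sub] at h1 h2 ⊢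
      rw [real_inner_comm (L (x k)) (y k), real_inner_comm (z k) (y k),
        real_inner_comm (L p) (y k), real_inner_comm q (y k)]
      linarith
    · simp only [inner_sub_left, inner_sub_right, inner_neg_right,
        ContinuousLinearMap.adjoint_inner_right, map_sub]
      rw [real_inner_comm (L p) v, real_inner_comm q v]
      ring
  rw [isPrimalDualSolution_zero_iff]
  -- Separating the sum: a negative `A`-term would make every `B`-term positive, so `v ∈ B (L xs)`
  -- by maximality; testing with that very pair makes the `B`-term zero, a contradiction.
  have hmemA : -((L†) v) ∈ A xs := by
    by_contra hcon
    have : ∃ p u, u ∈ A p ∧ inner ℝ (xs - p) (-((L†) v) - u) < 0 := by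
      by_contra! hno
      exact hcon (hA.mem hno)
    obtain ⟨p, u, hu, hneg⟩ := this
    have hmemB : v ∈ B (L xs) := hB.mem fun q w hw => by linarith [key p u q w hu hw]
    have := key p u _ _ hu hmemB
    simp only [sub_self, inner_zero_left] at this
    linarith
  refine ⟨hmemA, hB.mem fun q w hw => ?_⟩
  simpa using key _ _ q w hmemA hw

namespace IsRun

variable {A : H → Set H} {B : G → Set G} {L : H →L[ℝ] G} {c : ℝ}
  {M₁ : ℕ → H →L[ℝ] H} {M₂ : ℕ → G →L[ℝ] G} {x : ℕ → H} {z y : ℕ → G}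

/-- The energy bounds `z` and `y` directly. It bounds `x` only through `M₁`, so `L x` is bounded via
`z` and the residual before coercivity applies. -/
lemma exists_bound (h : IsRun A B L c M₁ M₂ x z y)
    (hsol : ∃ (xs : H) (v : G), IsPrimalDualSolution A B 0 L xs v)
    {β : ℝ} (hβ : 0 < β) (hco : ∀ k s, β * ‖s‖ ^ 2 ≤ inner ℝ (M₁ k s) s + ‖L s‖ ^ 2)
    (hr : Tendsto (fun k => L (x k) - z k) atTop (𝓝 0)) :
    ∃ R, ∀ k, ‖x k‖ ≤ R ∧ ‖z k‖ ≤ R ∧ ‖y k‖ ≤ R := by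
  obtain ⟨xs, v, hs⟩ := hsol
  have hc := h.c_pos
  obtain ⟨E, hE⟩ : ∃ E, ∀ k, energy c (M₁ k) (M₂ k) (x k - xs) (z k - L xs) (y k - v) ≤ E :=
    ⟨_, fun k => h.energy_antitone hs (Nat.zero_le k)⟩
  have hq₁ : ∀ k, 0 ≤ inner ℝ (M₁ k (x k - xs)) (x k - xs) := fun k =>
    (h.pos₁ k).inner_nonneg_left _
  have hq₂ : ∀ k, 0 ≤ inner ℝ (M₂ k (z k - L xs)) (z k - L xs) := fun k =>
    (h.pos₂ k).inner_nonneg_left _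
  have hq₃ : ∀ k, 0 ≤ c * ‖z k - L xs‖ ^ 2 := fun k => by positivity
  have hq₄ : ∀ k, 0 ≤ c⁻¹ * ‖y k - v‖ ^ 2 := fun k => by positivity
  unfold energy at hE
  obtain ⟨Rz, hRz⟩ := exists_norm_le_of_norm_sub_sq_le (u := z) (a := L xs) (C := E / c) fun k => by
    rw [le_div_iff₀ hc]
    linarith [hE k, hq₁ k, hq₂ k, hq₄ k]
  obtain ⟨Ry, hRy⟩ := exists_norm_le_of_norm_sub_sq_le (u := y) (a := v) (C := c * E) fun k => by
    rw [← inv_mul_le_iff₀ hc]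
    linarith [hE k, hq₁ k, hq₂ k, hq₃ k]
  obtain ⟨Rr, hRr⟩ := (Metric.isBounded_range_of_tendsto _ hr).exists_norm_le
  have hL : ∀ k, ‖L (x k - xs)‖ ≤ Rr + Rz + ‖L xs‖ := fun k => by
    have e : L (x k - xs) = (L (x k) - z k) + z k - L xs := by rw [map_sub]; abel
    rw [e]
    have h1 := norm_sub_le ((L (x k) - z k) + z k) (L xs)
    have h2 := norm_add_le (L (x k) - z k) (z k)
    linarith [hRr _ ⟨k, rfl⟩, hRz k]
  obtain ⟨Rx, hRx⟩ := exists_norm_le_of_norm_sub_sq_le (u := x) (a := xs)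
    (C := (E + (Rr + Rz + ‖L xs‖) ^ 2) / β) fun k => by
      rw [le_div_iff₀ hβ]
      have h1 := pow_le_pow_left₀ (norm_nonneg _) (hL k) 2
      linarith [hE k, hq₂ k, hq₃ k, hq₄ k, hco k (x k - xs)]
  exact ⟨max Rx (max Rz Ry), fun k => ⟨(hRx k).trans (le_max_left _ _),
    (hRz k).trans ((le_max_left _ _).trans (le_max_right _ _)),
    (hRy k).trans ((le_max_right _ _).trans (le_max_right _ _))⟩⟩

/-- Along every ultrafilter at infinity the iterates have a weak limit, which is a solution. -/
lemma exists_weak_limit_along (h : IsRun A B L c M₁ M₂ x z y)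
    (hsol : ∃ (xs : H) (v : G), IsPrimalDualSolution A B 0 L xs v)
    {R : ℝ} (hR : ∀ k, ‖x k‖ ≤ R ∧ ‖z k‖ ≤ R ∧ ‖y k‖ ≤ R)
    (hr : Tendsto (fun k => L (x k) - z k) atTop (𝓝 0))
    (hdz : Tendsto (fun k => z (k + 1) - z k) atTop (𝓝 0))
    (U : Ultrafilter ℕ) (hU : (U : Filter ℕ) ≤ atTop) :
    ∃ (xs : H) (v : G), IsPrimalDualSolution A B 0 L xs v ∧
      (∀ w, Tendsto (fun k => inner ℝ (x (k + 1)) w) U (𝓝 (inner ℝ xs w))) ∧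
      (∀ w, Tendsto (fun k => inner ℝ (z (k + 1)) w) U (𝓝 (inner ℝ (L xs) w))) ∧
      (∀ w, Tendsto (fun k => inner ℝ (y (k + 1)) w) U (𝓝 (inner ℝ v w))) := by
  obtain ⟨xs, hx⟩ := exists_weak_limit U (x := fun k => x (k + 1)) fun k => (hR (k + 1)).1
  obtain ⟨v, hy⟩ := exists_weak_limit U (x := fun k => y (k + 1)) fun k => (hR (k + 1)).2.2
  have hr' : Tendsto (fun k => L (x (k + 1)) - z (k + 1)) U (𝓝 0) :=
    (hr.comp (tendsto_add_atTop_nat 1)).mono_left hU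
  have hz : ∀ w, Tendsto (fun k => inner ℝ (z (k + 1)) w) U (𝓝 (inner ℝ (L xs) w)) := by
    intro w
    have h1 := (hx ((L†) w)).sub (hr'.inner (tendsto_const_nhds (x := w)))
    simp only [inner_zero_left, sub_zero, ContinuousLinearMap.adjoint_inner_right] at h1
    refine h1.congr fun k => ?_
    rw [inner_sub_left]
    ring
  refine ⟨xs, v, ?_, hx, hz, hy⟩
  have hM₁ := tendsto_apply_zero_of_inner h.pos₁ h.anti₁ (h.tendsto_inner_dx hsol)
  have hM₂ := tendsto_apply_zero_of_inner h.pos₂ h.anti₂ (h.tendsto_inner_dz hsol)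
  refine isPrimalDualSolution_of_weak_limit h.maxA h.maxB (l := U) (fun k => (hR (k + 1)).1)
    (fun k => (hR (k + 1)).2.1) (fun k => (hR (k + 1)).2.2) h.mem_A h.mem_B ?_ ?_ hr' hx hz hy
  · have h1 := ((((L†).continuous.tendsto 0).comp hdz).const_smul c).add hM₁ |>.neg
    simp only [map_zero, smul_zero, add_zero, neg_zero] at h1
    refine (h1.mono_left hU).congr fun k => ?_
    simp only [Function.comp_apply, map_add, map_smul]
    abel
  · have h1 := hM₂.neg
    rw [neg_zero] at h1
    refine (h1.mono_left hU).congr fun k => ?_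
    abel

/-- Opial's argument: weak limits of the iterates that are solutions coincide. -/
lemma weak_limit_unique (h : IsRun A B L c M₁ M₂ x z y)
    {β : ℝ} (hβ : 0 < β) (hco : ∀ k s, β * ‖s‖ ^ 2 ≤ inner ℝ (M₁ k s) s + ‖L s‖ ^ 2)
    {R : ℝ} (hR : ∀ k, ‖x k‖ ≤ R ∧ ‖z k‖ ≤ R ∧ ‖y k‖ ≤ R)
    {l₁ l₂ : Filter ℕ} [l₁.NeBot] [l₂.NeBot] (hl₁ : l₁ ≤ atTop) (hl₂ : l₂ ≤ atTop)
    {x₁ x₂ : H} {v₁ v₂ : G}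
    (hs₁ : IsPrimalDualSolution A B 0 L x₁ v₁) (hs₂ : IsPrimalDualSolution A B 0 L x₂ v₂)
    (hx₁ : ∀ w, Tendsto (fun k => inner ℝ (x (k + 1)) w) l₁ (𝓝 (inner ℝ x₁ w)))
    (hz₁ : ∀ w, Tendsto (fun k => inner ℝ (z (k + 1)) w) l₁ (𝓝 (inner ℝ (L x₁) w)))
    (hy₁ : ∀ w, Tendsto (fun k => inner ℝ (y (k + 1)) w) l₁ (𝓝 (inner ℝ v₁ w)))
    (hx₂ : ∀ w, Tendsto (fun k => inner ℝ (x (k + 1)) w) l₂ (𝓝 (inner ℝ x₂ w)))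
    (hz₂ : ∀ w, Tendsto (fun k => inner ℝ (z (k + 1)) w) l₂ (𝓝 (inner ℝ (L x₂) w)))
    (hy₂ : ∀ w, Tendsto (fun k => inner ℝ (y (k + 1)) w) l₂ (𝓝 (inner ℝ v₂ w))) :
    x₁ = x₂ ∧ v₁ = v₂ := by
  have hc := h.c_pos
  -- the cross terms in the difference of the two energies converge
  obtain ⟨E₁, hE₁⟩ := h.exists_tendsto_energy hs₁
  obtain ⟨E₂, hE₂⟩ := h.exists_tendsto_energy hs₂
  obtain ⟨p₁, hp₁⟩ := exists_tendsto_apply_of_antitone h.pos₁ h.anti₁ x₁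
  obtain ⟨p₂, hp₂⟩ := exists_tendsto_apply_of_antitone h.pos₁ h.anti₁ x₂
  obtain ⟨q₁, hq₁⟩ := exists_tendsto_apply_of_antitone h.pos₂ h.anti₂ (L x₁)
  obtain ⟨q₂, hq₂⟩ := exists_tendsto_apply_of_antitone h.pos₂ h.anti₂ (L x₂)
  have hcross : ∃ γ, Tendsto (fun k => inner ℝ (M₁ k (x₁ - x₂)) (x k)
      + inner ℝ (M₂ k (L x₁ - L x₂)) (z k) + c * inner ℝ (L x₁ - L x₂) (z k)
      + c⁻¹ * inner ℝ (v₁ - v₂) (y k)) atTop (𝓝 γ) := by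
    have hconst : ∀ {s : H} {v : G} {p : H} {q : G}, Tendsto (fun k => M₁ k s) atTop (𝓝 p) →
        Tendsto (fun k => M₂ k (L s)) atTop (𝓝 q) →
        Tendsto (fun k => energy c (M₁ k) (M₂ k) s (L s) v) atTop
          (𝓝 (inner ℝ p s + inner ℝ q (L s) + c * ‖L s‖ ^ 2 + c⁻¹ * ‖v‖ ^ 2)) :=
      fun hp hq => (((hp.inner tendsto_const_nhds).add (hq.inner tendsto_const_nhds)).add
        tendsto_const_nhds).add tendsto_const_nhds
    -- Terms quadratic in the iterates cancel in the difference. The remaining constants still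
    -- depend on `k` through the metrics, but these converge strongly.
    have := (((hE₂.sub hE₁).add (hconst (v := v₁) hp₁ hq₁)).sub
      (hconst (v := v₂) hp₂ hq₂)).const_mul 2⁻¹
    refine ⟨_, this.congr fun k => ?_⟩
    unfold energy
    rw [inner_sub_self_of_isPositive (h.pos₁ k), inner_sub_self_of_isPositive (h.pos₁ k),
      inner_sub_self_of_isPositive (h.pos₂ k), inner_sub_self_of_isPositive (h.pos₂ k),
      norm_sub_sq_real, norm_sub_sq_real, norm_sub_sq_real, norm_sub_sq_real,
      real_inner_comm (L x₁) (z k), real_inner_comm (L x₂) (z k), real_inner_comm v₁ (y k),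
      real_inner_comm v₂ (y k)]
    simp only [map_sub, inner_sub_left]
    ring
  obtain ⟨γ, hγ⟩ := hcross
  have hS := tendsto_add_atTop_nat 1
  have hd : Tendsto (fun k => M₁ k (x₁ - x₂)) atTop (𝓝 (p₁ - p₂)) := by
    simpa only [map_sub] using hp₁.sub hp₂
  have hLd : Tendsto (fun k => M₂ k (L x₁ - L x₂)) atTop (𝓝 (q₁ - q₂)) := by
    simpa only [map_sub] using hq₁.sub hq₂
  have hvalue : ∀ {l : Filter ℕ} [l.NeBot] {a : H} {v : G}, l ≤ atTop →
      (∀ w, Tendsto (fun k => inner ℝ (x (k + 1)) w) l (𝓝 (inner ℝ a w))) →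
      (∀ w, Tendsto (fun k => inner ℝ (z (k + 1)) w) l (𝓝 (inner ℝ (L a) w))) →
      (∀ w, Tendsto (fun k => inner ℝ (y (k + 1)) w) l (𝓝 (inner ℝ v w))) →
      γ = inner ℝ (p₁ - p₂) a + inner ℝ (q₁ - q₂) (L a) + c * inner ℝ (L x₁ - L x₂) (L a)
        + c⁻¹ * inner ℝ (v₁ - v₂) v := by
    intro l _ a v hl hx hz hy
    refine tendsto_nhds_unique ((hγ.comp hS).mono_left hl) ?_
    exact (((tendsto_inner_of_weak_limit (fun k => (hR (k + 1)).1) hx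
      ((hd.comp hS).mono_left hl)).add (tendsto_inner_of_weak_limit (fun k => (hR (k + 1)).2.1) hz
      ((hLd.comp hS).mono_left hl))).add ((tendsto_inner_of_weak_limit
      (fun k => (hR (k + 1)).2.1) hz tendsto_const_nhds).const_mul c)).add
      ((tendsto_inner_of_weak_limit
      (fun k => (hR (k + 1)).2.2) hy tendsto_const_nhds).const_mul c⁻¹)
  have heq := (hvalue hl₁ hx₁ hz₁ hy₁).symm.trans (hvalue hl₂ hx₂ hz₂ hy₂)
  -- Subtracting the two expressions for `γ` gives a vanishing sum of nonnegative terms.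
  have hzero : inner ℝ (p₁ - p₂) (x₁ - x₂) + inner ℝ (q₁ - q₂) (L x₁ - L x₂)
      + c * ‖L x₁ - L x₂‖ ^ 2 + c⁻¹ * ‖v₁ - v₂‖ ^ 2 = 0 := by
    rw [← real_inner_self_eq_norm_sq, ← real_inner_self_eq_norm_sq,
      inner_sub_right (p₁ - p₂), inner_sub_right (q₁ - q₂), inner_sub_right (L x₁ - L x₂),
      inner_sub_right (v₁ - v₂)]
    linarith
  have hpd := hd.inner (𝕜 := ℝ) (tendsto_const_nhds (x := x₁ - x₂))
  have hpd0 := ge_of_tendsto' hpd fun k => (h.pos₁ k).inner_nonneg_left _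
  have hqd0 := ge_of_tendsto' (hLd.inner (𝕜 := ℝ) (tendsto_const_nhds (x := L x₁ - L x₂)))
    fun k => (h.pos₂ k).inner_nonneg_left _
  have hcoer := ge_of_tendsto' (hpd.add_const (‖L (x₁ - x₂)‖ ^ 2)) fun k => hco k _
  rw [map_sub] at hcoer
  have h3 : 0 ≤ c * ‖L x₁ - L x₂‖ ^ 2 := by positivity
  have h4 : 0 ≤ c⁻¹ * ‖v₁ - v₂‖ ^ 2 := by positivity
  have hv : c⁻¹ * ‖v₁ - v₂‖ ^ 2 = 0 := by linarith
  have hL : c * ‖L x₁ - L x₂‖ ^ 2 = 0 := by linarith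
  have hLz : ‖L x₁ - L x₂‖ ^ 2 = 0 := (mul_eq_zero.1 hL).resolve_left hc.ne'
  have hx : β * ‖x₁ - x₂‖ ^ 2 = 0 := le_antisymm (by linarith) (by positivity)
  constructor
  · simpa [hβ.ne', sub_eq_zero] using hx
  · simpa [hc.ne', sub_eq_zero] using hv

/-- Vanishing residuals and coercivity imply weak convergence to a solution. -/
lemma exists_weaklyConverges (h : IsRun A B L c M₁ M₂ x z y)
    (hsol : ∃ (xs : H) (v : G), IsPrimalDualSolution A B 0 L xs v)
    {β : ℝ} (hβ : 0 < β) (hco : ∀ k s, β * ‖s‖ ^ 2 ≤ inner ℝ (M₁ k s) s + ‖L s‖ ^ 2)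
    (hr : Tendsto (fun k => L (x k) - z k) atTop (𝓝 0))
    (hdz : Tendsto (fun k => z (k + 1) - z k) atTop (𝓝 0)) :
    ∃ (xs : H) (v : G), IsPrimalDualSolution A B 0 L xs v ∧
      WeaklyConverges (fun k => (x k, z k, y k)) (xs, L xs, v) := by
  obtain ⟨R, hR⟩ := h.exists_bound hsol hβ hco hr
  obtain ⟨xs, v, hs, hx, hz, hy⟩ :=
    h.exists_weak_limit_along hsol hR hr hdz (Ultrafilter.of atTop) (Ultrafilter.of_le _)
  refine ⟨xs, v, hs, ?_⟩
  -- The limit along one chosen ultrafilter is the limit along all of them, which is convergence.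
  have key : ∀ U : Ultrafilter ℕ, (U : Filter ℕ) ≤ atTop →
      (∀ w, Tendsto (fun k => inner ℝ (x (k + 1)) w) U (𝓝 (inner ℝ xs w))) ∧
      (∀ w, Tendsto (fun k => inner ℝ (z (k + 1)) w) U (𝓝 (inner ℝ (L xs) w))) ∧
      (∀ w, Tendsto (fun k => inner ℝ (y (k + 1)) w) U (𝓝 (inner ℝ v w))) := by
    intro U hU
    obtain ⟨xs', v', hs', hx', hz', hy'⟩ := h.exists_weak_limit_along hsol hR hr hdz U hU
    obtain ⟨rfl, rfl⟩ := h.weak_limit_unique hβ hco hR (Ultrafilter.of_le _) hU hs hs'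
      hx hz hy hx' hz' hy'
    exact ⟨hx', hz', hy'⟩
  refine weaklyConverges_of_inner (fun w => ?_) (fun w => ?_) (fun w => ?_)
  · exact (tendsto_add_atTop_iff_nat (f := fun k => inner ℝ (x k) w) 1).1
      ((tendsto_iff_ultrafilter _ _ _).2 fun U hU => (key U hU).1 w)
  · exact (tendsto_add_atTop_iff_nat (f := fun k => inner ℝ (z k) w) 1).1
      ((tendsto_iff_ultrafilter _ _ _).2 fun U hU => (key U hU).2.1 w)
  · exact (tendsto_add_atTop_iff_nat (f := fun k => inner ℝ (y k) w) 1).1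
      ((tendsto_iff_ultrafilter _ _ _).2 fun U hU => (key U hU).2.2 w)

lemma tendsto_residual_of_tendsto_dz (h : IsRun A B L c M₁ M₂ x z y)
    (hsol : ∃ (xs : H) (v : G), IsPrimalDualSolution A B 0 L xs v)
    (hdz : Tendsto (fun k => z (k + 1) - z k) atTop (𝓝 0)) :
    Tendsto (fun k => L (x k) - z k) atTop (𝓝 0) := by
  refine (tendsto_add_atTop_iff_nat (f := fun k => L (x k) - z k) 1).1 ?_
  simpa using (h.tendsto_shifted_residual hsol).sub hdz

lemma tendsto_residual_of_coercive₁ (h : IsRun A B L c M₁ M₂ x z y)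
    (hsol : ∃ (xs : H) (v : G), IsPrimalDualSolution A B 0 L xs v)
    {α : ℝ} (hα : 0 < α) (hM : ∀ k, PClass α (M₁ k)) :
    Tendsto (fun k => L (x k) - z k) atTop (𝓝 0) := by
  have hdx := tendsto_zero_of_coercive hα hM (h.tendsto_inner_dx hsol)
  have hL := (L.continuous.tendsto 0).comp hdx
  rw [map_zero] at hL
  have := (h.tendsto_shifted_residual hsol).sub hL
  rw [sub_zero] at this
  exact this.congr fun k => by simp only [Function.comp_apply, map_sub]; abel

lemma tendsto_dz_of_residual (h : IsRun A B L c M₁ M₂ x z y)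
    (hsol : ∃ (xs : H) (v : G), IsPrimalDualSolution A B 0 L xs v)
    (hr : Tendsto (fun k => L (x k) - z k) atTop (𝓝 0)) :
    Tendsto (fun k => z (k + 1) - z k) atTop (𝓝 0) := by
  have := (h.tendsto_shifted_residual hsol).sub (hr.comp (tendsto_add_atTop_nat 1))
  rw [sub_zero] at this
  exact this.congr fun k => by simp only [Function.comp_apply]; abel

/-- If the second metrics at most halve in each step, the increments of `z` vanish. -/
lemma tendsto_dz_of_le_two_smul (h : IsRun A B L c M₁ M₂ x z y)
    (hsol : ∃ (xs : H) (v : G), IsPrimalDualSolution A B 0 L xs v)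
    (hM : ∀ k, M₂ k ≤ (2 : ℝ) • M₂ (k + 1)) :
    Tendsto (fun k => z (k + 1) - z k) atTop (𝓝 0) := by
  have hc := h.c_pos
  refine (tendsto_add_atTop_iff_nat (f := fun k => z (k + 1) - z k) 1).1 ?_
  have hlim := ((h.tendsto_norm_sq_shifted_residual hsol).comp (tendsto_add_atTop_nat 1)).add
    ((h.tendsto_inner_dz hsol).const_mul c⁻¹)
  rw [mul_zero, add_zero] at hlim
  have hsq : Tendsto (fun k => ‖z (k + 1 + 1) - z (k + 1)‖ ^ 2) atTop (𝓝 0) := by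
    refine squeeze_zero (fun k => sq_nonneg _) (fun k => ?_) hlim
    -- With `e` the new increment and `d` the old one, this gives `2c⟪e, r⟫ ≥ 2⟪M₂ (k+1) e, e⟫ -
    -- 2⟪M₂ k d, e⟫ ≥ ⟪M₂ k e, e⟫ - 2⟪M₂ k d, e⟫ ≥ -⟪M₂ k d, d⟫`, the factor 2 entering in the
    -- middle. Expanding `‖r + e‖²` then bounds `‖e‖²`.
    have hmono := h.maxB.1 _ _ _ _ (h.mem_B (k + 1)) (h.mem_B k)
    simp only [Function.comp_apply]
    set e := z (k + 1 + 1) - z (k + 1) with he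
    set d := z (k + 1) - z k with hd
    set r := L (x (k + 1 + 1)) - z (k + 1 + 1) with hr
    have hy : y (k + 1 + 1) = y (k + 1) + c • r := h.gen.y_step (k + 1)
    have hres : L (x (k + 1 + 1)) - z (k + 1) = r + e := by rw [hr, he]; abel
    have e1 : y (k + 1 + 1) - M₂ (k + 1) e - (y (k + 1) - M₂ k d)
        = c • r - M₂ (k + 1) e + M₂ k d := by rw [hy]; abel
    rw [e1, inner_add_right, inner_sub_right, inner_smul_right, real_inner_comm (M₂ (k + 1) e) e,
      real_inner_comm (M₂ k d) e] at hmono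
    have h1 := inner_self_le_of_le (hM k) e
    rw [smul_apply, inner_smul_left, conj_trivial] at h1
    have h2 := (h.pos₂ k).inner_nonneg_left (e - d)
    rw [inner_sub_self_of_isPositive (h.pos₂ k)] at h2
    have h3 : 0 ≤ 2 * inner ℝ e r + c⁻¹ * inner ℝ (M₂ k d) d := by
      have h4 : 0 ≤ c * (2 * inner ℝ e r + c⁻¹ * inner ℝ (M₂ k d) d) := by
        rw [mul_add, mul_inv_cancel_left₀ hc.ne']
        linarith
      exact nonneg_of_mul_nonneg_right h4 hc
    rw [hres, norm_add_sq_real, real_inner_comm]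
    linarith [sq_nonneg ‖r‖]
  rw [tendsto_zero_iff_norm_tendsto_zero]
  simpa using hsq.sqrt

end IsRun

/-- An injective operator on a finite-dimensional space is bounded below. -/
lemma exists_pClass_adjoint_comp_self [FiniteDimensional ℝ H] {L : H →L[ℝ] G}
    (hL : Function.Injective L) : ∃ α : ℝ, 0 < α ∧ PClass α ((L†) ∘L L) := by
  obtain ⟨K, hK, hLK⟩ := (LinearMap.injective_iff_antilipschitz L.toLinearMap).1 hL
  have hK' : (0 : ℝ) < K := hK
  -- `K` is an antilipschitz constant of `L`: `‖s‖ ≤ K ‖L s‖`.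
  refine ⟨((K : ℝ) ^ 2)⁻¹, by positivity, L.isPositive_adjoint_comp_self, ?_⟩
  rw [ContinuousLinearMap.le_def, ContinuousLinearMap.isPositive_iff]
  refine ⟨?_, fun s => ?_⟩
  · intro p q
    simp [inner_sub_left, inner_sub_right, inner_smul_left, inner_smul_right,
      ContinuousLinearMap.adjoint_inner_left, ContinuousLinearMap.adjoint_inner_right]
  · have h1 : ‖s‖ ≤ K * ‖L s‖ := by
      simpa using hLK.le_mul_dist s 0
    have h2 : ((K : ℝ) ^ 2)⁻¹ * ‖s‖ ^ 2 ≤ ‖L s‖ ^ 2 := by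
      rw [inv_mul_le_iff₀ (by positivity), ← mul_pow]
      gcongr
    simpa [inner_sub_left, inner_smul_left, ContinuousLinearMap.adjoint_inner_left] using h2

lemma PClass.mul_norm_sq_le_norm_apply_sq {L : H →L[ℝ] G} {α : ℝ} (h : PClass α ((L†) ∘L L))
    (s : H) : α * ‖s‖ ^ 2 ≤ ‖L s‖ ^ 2 := by
  simpa [ContinuousLinearMap.adjoint_inner_left] using h.mul_norm_sq_le s

end Convergence

end ADMM

/-! ### The convergence theorem -/

theorem theorem2 {H G : Type*}
    [NormedAddCommGroup H] [InnerProductSpace ℝ H] [CompleteSpace H]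
    [NormedAddCommGroup G] [InnerProductSpace ℝ G] [CompleteSpace G]
    (A : H → Set H) (B : G → Set G) (L : H →L[ℝ] G)
    (hA : ADMM.IsMaximallyMonotone A) (hB : ADMM.IsMaximallyMonotone B)
    -- the set of primal-dual solutions (for `C = 0`) is nonempty
    (hsol : ∃ (x : H) (v : G), ADMM.IsPrimalDualSolution A B 0 L x v) :
    (∀ (c : ℝ) (M₁ : ℕ → H →L[ℝ] H) (M₂ : ℕ → G →L[ℝ] G) (x : ℕ → H) (z y : ℕ → G),
      0 < c →
      (∀ k, (M₁ k).IsPositive) →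
      (∀ k, (M₂ k).IsPositive) →
      (∀ k, ∃ α : ℝ, 0 < α ∧ ADMM.PClass α (c • ((L†) ∘L L) + M₁ k)) →
      ADMM.Generates A B 0 L c M₁ M₂ x z y →
      (∀ k, M₁ (k + 1) ≤ M₁ k) →
      (∀ k, M₂ (k + 1) ≤ M₂ k) →
      ((∃ α₁ : ℝ, 0 < α₁ ∧ ∀ k, ADMM.PClass α₁ (M₁ k)) ∨
        (∃ α α₂ : ℝ, 0 < α ∧ 0 < α₂ ∧ ADMM.PClass α ((L†) ∘L L) ∧
          ∀ k, ADMM.PClass α₂ (M₂ k)) ∨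
        (∃ α : ℝ, 0 < α ∧ ADMM.PClass α ((L†) ∘L L) ∧
          ∀ k, M₂ k ≤ (2 : ℝ) • M₂ (k + 1) ∧ M₂ (k + 1) ≤ M₂ k)) →
      ∃ (xs : H) (v : G), ADMM.IsPrimalDualSolution A B 0 L xs v ∧
        ADMM.WeaklyConverges (fun k => (x k, z k, y k)) (xs, L xs, v)) ∧
    -- in particular: classical ADMM (`M₁ = M₂ = 0`) in finite dimensions, `L` of full column rank
    (FiniteDimensional ℝ H → FiniteDimensional ℝ G → Function.Injective L →
      ∀ (c : ℝ) (x : ℕ → H) (z y : ℕ → G),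
        0 < c →
        ADMM.Generates A B 0 L c (fun _ => 0) (fun _ => 0) x z y →
        ∃ (xs : H) (v : G), ADMM.IsPrimalDualSolution A B 0 L xs v ∧
          Tendsto (fun k => (x k, z k, y k)) atTop (𝓝 (xs, L xs, v))) := by
  have main : ∀ (c : ℝ) (M₁ : ℕ → H →L[ℝ] H) (M₂ : ℕ → G →L[ℝ] G) (x : ℕ → H) (z y : ℕ → G),
      ADMM.IsRun A B L c M₁ M₂ x z y →
      ((∃ α₁ : ℝ, 0 < α₁ ∧ ∀ k, ADMM.PClass α₁ (M₁ k)) ∨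
        (∃ α α₂ : ℝ, 0 < α ∧ 0 < α₂ ∧ ADMM.PClass α ((L†) ∘L L) ∧
          ∀ k, ADMM.PClass α₂ (M₂ k)) ∨
        (∃ α : ℝ, 0 < α ∧ ADMM.PClass α ((L†) ∘L L) ∧
          ∀ k, M₂ k ≤ (2 : ℝ) • M₂ (k + 1) ∧ M₂ (k + 1) ≤ M₂ k)) →
      ∃ (xs : H) (v : G), ADMM.IsPrimalDualSolution A B 0 L xs v ∧
        ADMM.WeaklyConverges (fun k => (x k, z k, y k)) (xs, L xs, v) := by
    intro c M₁ M₂ x z y h hcases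
    have hcoL : ∀ {α : ℝ}, ADMM.PClass α ((L†) ∘L L) → ∀ k s,
        α * ‖s‖ ^ 2 ≤ inner ℝ (M₁ k s) s + ‖L s‖ ^ 2 := fun hP k s =>
      (hP.mul_norm_sq_le_norm_apply_sq s).trans
        (le_add_of_nonneg_left ((h.pos₁ k).inner_nonneg_left s))
    rcases hcases with ⟨α, hα, hM⟩ | ⟨α, α₂, hα, hα₂, hL, hM⟩ | ⟨α, hα, hL, hM⟩
    · have hr := h.tendsto_residual_of_coercive₁ hsol hα hM
      exact h.exists_weaklyConverges hsol hα
        (fun k s => ((hM k).mul_norm_sq_le s).trans (le_add_of_nonneg_right (sq_nonneg _)))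
        hr (h.tendsto_dz_of_residual hsol hr)
    · have hdz := ADMM.tendsto_zero_of_coercive hα₂ hM (h.tendsto_inner_dz hsol)
      exact h.exists_weaklyConverges hsol hα (hcoL hL)
        (h.tendsto_residual_of_tendsto_dz hsol hdz) hdz
    · have hdz := h.tendsto_dz_of_le_two_smul hsol fun k => (hM k).1
      exact h.exists_weaklyConverges hsol hα (hcoL hL)
        (h.tendsto_residual_of_tendsto_dz hsol hdz) hdz
  refine ⟨fun c M₁ M₂ x z y hc h₁ h₂ _ hgen ha₁ ha₂ =>
    main c M₁ M₂ x z y ⟨hA, hB, hc, h₁, h₂, ha₁, ha₂, hgen⟩, ?_⟩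
  intro _ _ hL c x z y hc hgen
  obtain ⟨α, hα, hP⟩ := ADMM.exists_pClass_adjoint_comp_self hL
  obtain ⟨xs, v, hs, hw⟩ := main c _ _ x z y
    ⟨hA, hB, hc, fun _ => ContinuousLinearMap.isPositive_zero,
      fun _ => ContinuousLinearMap.isPositive_zero, fun _ => le_rfl, fun _ => le_rfl, hgen⟩
    -- Zero metrics satisfy the third alternative trivially.
    (Or.inr (Or.inr ⟨α, hα, hP, fun _ => by simp⟩))
  exact ⟨xs, v, hs, hw.tendsto⟩
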